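/- Conventions. Let $R=\{x\in\mathbb{R}^3:\|x\|\le 1\}$, $c>0$, $\Omega=cR$, and let $L$ be a positive integer. For $f\in L^2(\mathbb{R}^3)$ (complex valued) let $\mathcal{F}[f](\omega)=\int_{\mathbb{R}^3}f(x)e^{-i\langle\omega,x\rangle}\,dx$, understood in the sense of Plancherel, and $$\delta_c=(2\pi)^{-3/2}\,\|\mathcal{F}[f]\|_{L^2(\mathbb{R}^3\setminus\Omega)}.$$ Let $\psi_{N,m,n}$ ($N,n\in\mathbb{N}=\{0,1,2,\dots\}$, $m\in\mathbb{Z}$, $-N\le m\le N$) be the generalized prolate spheroidal wave functions of bandlimit $c$ with eigenvalues $\alpha_{N,n}\in\mathbb{C}$. That is, the $\psi_{N,m,n}$ are eigenfunctions, $$\alpha_{N,n}\,\psi_{N,m,n}(x)=\int_R e^{ic\langle x,y\rangle}\psi_{N,m,n}(y)\,dy,\qquad x\in R,$$ they are orthonormal in $L^2(R)$, and they exhaust the eigenfunctions: every $L^2(R)$-eigenfunction of this equation that is orthogonal in $L^2(R)$ to all the $\psi_{N,m,n}$ is zero almost everywhere on $R$. Put $$b_{N,m,n}=\Big(\frac{c}{2\pi}\Big)^3\int_R\mathcal{F}[f](c\omega)\,\overline{\psi_{N,m,n}(\omega)}\,d\omega,\qquad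 \tilde\alpha_{N,n}=\Big(\frac{c}{2\pi}\Big)^3|\alpha_{N,n}|^2 .$$ Theorem. Suppose that $f\in L^2(\mathbb{R}^3)$, that $\|f\chi_{R^c}\|_{L^2(\mathbb{R}^3)}\le\epsilon$ with $\epsilon\ge 0$, and that $\{f(k/L)\}_{k\in\mathbb{Z}^3}\in\ell^2$. Then $\tilde\alpha_{N,n}<1$ for all $N,n$, and for every finite set $\Pi$ of indices $(N,m,n)$ the maximum below is attained and $$\Big\|f-\sum_{(N,m,n)\in\Pi}b_{N,m,n}\,\alpha_{N,n}\,\psi_{N,m,n}\Big\|_{L^2(R)}\le(\epsilon+\delta_c)\sqrt{\max_{(N,m,n)\notin\Pi}\frac{\tilde\alpha_{N,n}}{1-\tilde\alpha_{N,n}}}+2\delta_c .$$ -/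

import Mathlib

open MeasureTheory
open scoped FourierTransform

noncomputable section

namespace GPSWF

/-- Euclidean three-space. -/
abbrev E3 : Type := EuclideanSpace ℝ (Fin 3)

/-- The closed ball of radius `r` centred at the origin. -/
abbrev ball (r : ℝ) : Set E3 := Metric.closedBall 0 r

/-- The closed unit ball `R`. -/
abbrev unitBall : Set E3 := ball 1

/-- The grid point `k / L`. -/
def gridPoint (L : ℕ) (k : Fin 3 → ℤ) : E3 := WithLp.toLp 2 fun j => (k j : ℝ) / (L : ℝ)

/-- The Fourier transform `F[f](ω) = ∫ f(x) exp(-i ⟨ω, x⟩) dx` of a square integrable function, in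
the sense of Plancherel. Mathlib's transform on `L²` extends `ξ ↦ ∫ f(x) exp(-2πi ⟨x, ξ⟩) dx`, hence
the evaluation at `ω / (2π)`. -/
def fourier (f : E3 → ℂ) (hf : MemLp f 2 volume) (ω : E3) : ℂ :=
  (𝓕 (hf.toLp f) : Lp (α := E3) ℂ 2 (volume : Measure E3)) ((2 * Real.pi)⁻¹ • ω)

/-- `δ_c = (2π)^(-3/2) ‖F[f]‖` with the norm of `L²` of the complement of the ball of radius `c`. -/
def deltaC (c : ℝ) (f : E3 → ℂ) (hf : MemLp f 2 volume) : ℝ :=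
  (2 * Real.pi) ^ (-(3 / 2) : ℝ) *
    (eLpNorm (fourier f hf) 2 (volume.restrict (ball c)ᶜ)).toReal

/-- `φ` is square integrable on the unit ball and solves
`μ φ(x) = ∫_R exp(i c ⟨x, y⟩) φ(y) dy` for all `x ∈ R`. -/
structure SolvesEigenEq (c : ℝ) (μ : ℂ) (φ : E3 → ℂ) : Prop where
  memLp : MemLp φ 2 (volume.restrict unitBall)
  eq : ∀ x ∈ unitBall,
    μ * φ x = ∫ y in unitBall, Complex.exp (Complex.I * ((c * inner ℝ x y : ℝ) : ℂ)) * φ y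

/-- The indices `(N, m, n)` with `N, n ∈ ℕ` and `m ∈ ℤ`, `-N ≤ m ≤ N`. -/
structure Index where
  N : ℕ
  m : ℤ
  n : ℕ
  neg_le_m : -(N : ℤ) ≤ m
  m_le : m ≤ (N : ℤ)

/-- `ψ` is a system of generalized prolate spheroidal wave functions of bandlimit `c`, with
eigenvalues `α N n`: the `ψ (N, m, n)` are eigenfunctions of the integral equation, orthonormal in
`L²(R)`, and they exhaust the eigenfunctions, in that every eigenfunction orthogonal in `L²(R)` to
all of them vanishes almost everywhere on `R`. -/
structure IsSystem (c : ℝ) (ψ : Index → E3 → ℂ) (α : ℕ → ℕ → ℂ) : Prop where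
  eigen : ∀ i, SolvesEigenEq c (α i.N i.n) (ψ i)
  normalized : ∀ i, ∫ x in unitBall, ‖ψ i x‖ ^ 2 = 1
  orthogonal : ∀ i j, i ≠ j → ∫ x in unitBall, ψ i x * starRingEnd ℂ (ψ j x) = 0
  exhaustive : ∀ (μ : ℂ) (φ : E3 → ℂ), SolvesEigenEq c μ φ →
    (∀ i, ∫ x in unitBall, φ x * starRingEnd ℂ (ψ i x) = 0) →
      ∀ᵐ x ∂(volume.restrict unitBall), φ x = 0

/-- `b_{N,m,n} = (c / 2π)³ ∫_R F[f](c ω) conj (ψ_{N,m,n}(ω)) dω`. -/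
def coeffB (c : ℝ) (ψ : Index → E3 → ℂ) (f : E3 → ℂ) (hf : MemLp f 2 volume) (i : Index) : ℂ :=
  (((c / (2 * Real.pi)) ^ 3 : ℝ) : ℂ) *
    ∫ ω in unitBall, fourier f hf (c • ω) * starRingEnd ℂ (ψ i ω)

/-- `α̃_{N,n} = (c / 2π)³ |α_{N,n}|²`. -/
def alphaTilde (c : ℝ) (α : ℕ → ℕ → ℂ) (N n : ℕ) : ℝ :=
  (c / (2 * Real.pi)) ^ 3 * ‖α N n‖ ^ 2

end GPSWF

end

/-! Write κ = c/2π, let T be the finite Fourier transform (`finiteFT`, `finiteFTOp`) and h(ω) =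
F[f](cω) on R. The band-limited part of f is g = κ³ T h, and Plancherel gives ‖f - g‖ = δ_c on the
whole space (`integral_norm_sq_sub_finiteFT`). Hence the energy of g outside R is at most (ε +
δ_c)², and it remains to bound the expansion error of g on R by that energy.

On L²(R), T is compact, and its adjoint is S T, where S is the reflection u ↦ u(-·) and commutes
with T. So T is normal, and since the ψ exhaust the eigenfunctions they form a Hilbert basis
(`eq_zero_of_forall_inner_eigenvector`). In this basis b = κ³⟨ψ, h⟩, and the error of g on R has
squared norm κ⁶ Σ_{i ∉ Π} |α_i|² |⟨ψ_i, h⟩|². Plancherel for T on the whole space turns the energy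
outside R into κ⁶ Σ_i (κ⁻³ - |α_i|²) |⟨ψ_i, h⟩|². Comparing termwise produces the ratio α̃/(1 - α̃)
(`norm_sq_apply_sub_sum_le`).

Strictness α̃ < 1 means that T ψ_i has energy outside R, which follows from analyticity along lines
(`setIntegral_compl_pos`). The maximum exists because T is Hilbert–Schmidt, so that α̃ → 0
(`sum_norm_sq_le`). -/

namespace GPSWF
open scoped SchwartzMap

/-! ### The `L²` Fourier transform as an integral, and `L²` norms -/

/-- The inverse Fourier transform on `L²` agrees with the integral on `L¹ ∩ L²`. -/
theorem coeFn_fourierInv_toLp {g : E3 → ℂ} (hg : MemLp g 2 volume) (hg1 : Integrable g) :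
    ((𝓕⁻ (hg.toLp g) : Lp (α := E3) ℂ 2 volume) : E3 → ℂ) =ᵐ[volume] 𝓕⁻ g := by
  have hcont : Continuous (𝓕⁻ g) := by
    have h : Continuous (𝓕 g) := VectorFourier.fourierIntegral_continuous
      Real.continuous_fourierChar (L := innerₗ E3) continuous_inner hg1
    have : (𝓕⁻ g) = fun x => 𝓕 g (-x) := by
      funext x; exact Real.fourierInv_eq_fourier_neg g x
    rw [this]
    exact h.comp continuous_neg
  -- Both sides are tested against smooth compactly supported functions: the distributional
  -- transform moves `𝓕⁻` onto the test function, and Fubini (`h3`) moves it back onto `g`.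
  refine ae_eq_of_integral_contDiff_smul_eq ((Lp.memLp _).locallyIntegrable (by norm_num))
    hcont.locallyIntegrable ?_
  intro φ hφ hφc
  have hc : HasCompactSupport (Complex.ofRealCLM ∘ φ) := hφc.comp_left rfl
  have hs : ContDiff ℝ (⊤ : ℕ∞) (Complex.ofRealCLM ∘ φ) := Complex.ofRealCLM.contDiff.comp hφ
  set Φ : 𝓢(E3, ℂ) := hc.toSchwartzMap hs with hΦ
  have hΦφ : ∀ x, Φ x = (φ x : ℂ) := fun x => rfl
  have h1 := congrArg (fun D : 𝓢'(E3, ℂ) => D Φ)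
    (Lp.fourierInv_toTemperedDistribution_eq (hg.toLp g))
  simp only [TemperedDistribution.fourierInv_apply, Lp.toTemperedDistribution_apply] at h1
  have h2 : ∫ x, (𝓕⁻ Φ) x • (hg.toLp g) x = ∫ x, (𝓕⁻ Φ) x • g x :=
    integral_congr_ae (by filter_upwards [hg.coeFn_toLp] with x hx; rw [hx])
  have h3 : ∫ x, (𝓕⁻ (Φ : E3 → ℂ)) x • g x = ∫ x, Φ x • (𝓕⁻ g) x := by
    have := VectorFourier.integral_fourierIntegral_smul_eq_flip (L := -(innerₗ E3))
      (μ := volume) (ν := volume) (e := Real.fourierChar) Real.continuous_fourierChar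
      (by simpa using! continuous_inner.neg) Φ.integrable hg1
    simpa [VectorFourier.fourierIntegral, Real.fourierInv_eq, real_inner_comm] using this
  rw [SchwartzMap.fourierInv_coe] at h2
  have h4 : ∀ k : E3 → ℂ, ∫ x, φ x • k x = ∫ x, Φ x • k x := fun k => by simp [hΦφ]
  rw [h4, h4, ← h3, ← h2, ← SchwartzMap.fourierInv_coe]
  exact h1.symm

theorem eLpNorm_two_eq_ofReal_sqrt {X : Type*} [MeasurableSpace X] {μ : Measure X} {g : X → ℂ}
    (hg : MemLp g 2 μ) : eLpNorm g 2 μ = ENNReal.ofReal (Real.sqrt (∫ x, ‖g x‖ ^ 2 ∂μ)) := by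
  rw [hg.eLpNorm_eq_integral_rpow_norm (by norm_num) (by norm_num), Real.sqrt_eq_rpow]
  norm_num

theorem norm_toLp_sq {X : Type*} [MeasurableSpace X] {μ : Measure X} {g : X → ℂ}
    (hg : MemLp g 2 μ) : ‖hg.toLp g‖ ^ 2 = ∫ x, ‖g x‖ ^ 2 ∂μ := by
  rw [Lp.norm_toLp, eLpNorm_two_eq_ofReal_sqrt hg, ENNReal.toReal_ofReal (Real.sqrt_nonneg _),
    Real.sq_sqrt (integral_nonneg fun _ => by positivity)]

theorem norm_Lp_sq {X : Type*} [MeasurableSpace X] {μ : Measure X} (u : Lp ℂ 2 μ) :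
    ‖u‖ ^ 2 = ∫ x, ‖u x‖ ^ 2 ∂μ := by
  rw [← norm_toLp_sq (Lp.memLp u), Lp.toLp_coeFn]

/-! ### The finite Fourier transform on the whole space -/

/-- The finite Fourier transform `x ↦ ∫_R exp(i c ⟨x, y⟩) u(y) dy` on the unit ball. -/
noncomputable def finiteFT (c : ℝ) (u : E3 → ℂ) (x : E3) : ℂ :=
  ∫ y in unitBall, Complex.exp (Complex.I * ((c * inner ℝ x y : ℝ) : ℂ)) * u y

theorem memLp_comp_inv_smul {U : E3 → ℂ} {p : ENNReal} {r : ℝ} (hr : 0 < r)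
    (hU : MemLp U p volume) : MemLp (fun x => U (r⁻¹ • x)) p volume := by
  have hm : AEMeasurable (fun x : E3 => r⁻¹ • x) volume := by fun_prop
  have hmap := Measure.map_addHaar_smul (volume : Measure E3) (inv_ne_zero hr.ne')
  have h : MemLp U p (Measure.map (fun x : E3 => r⁻¹ • x) volume) := by
    have e : Measure.map (fun x : E3 => r⁻¹ • x) volume =
        Measure.map (r⁻¹ • ·) (volume : Measure E3) := rfl
    rw [e, hmap]
    exact hU.smul_measure ENNReal.ofReal_ne_top
  exact h.comp_of_map hm

theorem memLp_indicator_unitBall {u : E3 → ℂ} {p : ENNReal}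
    (hu : MemLp u p (volume.restrict unitBall)) : MemLp (unitBall.indicator u) p volume :=
  (memLp_indicator_iff_restrict Metric.isClosed_closedBall.measurableSet).2 hu

instance : IsFiniteMeasure ((volume : Measure E3).restrict unitBall) :=
  ⟨by simp⟩

/-- With ξ = κη the phase 2π⟨ξ, x⟩ becomes c⟨x, η⟩, and the Jacobian is κ³. -/
theorem fourierInv_dilate_indicator {c : ℝ} (hc : 0 < c) (u : E3 → ℂ) (x : E3) :
    𝓕⁻ (fun ξ : E3 => unitBall.indicator u ((c / (2 * Real.pi))⁻¹ • ξ)) x =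
      (((c / (2 * Real.pi)) ^ 3 : ℝ) : ℂ) * finiteFT c u x := by
  have hκ : 0 < c / (2 * Real.pi) := by positivity
  have hcκ : c = 2 * Real.pi * (c / (2 * Real.pi)) := by field_simp
  set κ := c / (2 * Real.pi)
  have h := Measure.integral_comp_inv_smul (volume : Measure E3)
    (fun η => Complex.exp (Complex.I * ((c * inner ℝ x η : ℝ) : ℂ)) * unitBall.indicator u η) κ
  rw [Real.fourierInv_eq']
  have h3 : Module.finrank ℝ E3 = 3 := by simp
  rw [h3, abs_of_pos (by positivity)] at h
  have hI : finiteFT c u x =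
      ∫ η, Complex.exp (Complex.I * ((c * inner ℝ x η : ℝ) : ℂ)) * unitBall.indicator u η := by
    rw [finiteFT, ← integral_indicator Metric.isClosed_closedBall.measurableSet]
    congr 1; funext η
    by_cases hη : η ∈ unitBall
    · simp [Set.indicator_of_mem hη]
    · simp [Set.indicator_of_notMem hη]
  rw [hI, ← Complex.real_smul, ← h]
  congr 1; funext ξ
  rw [smul_eq_mul]
  congr 2
  rw [inner_smul_right, real_inner_comm, hcκ, mul_comm Complex.I]
  congr 2
  field_simp

theorem integral_norm_sq_dilate_indicator {κ : ℝ} (hκ : 0 < κ) (u : E3 → ℂ) :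
    ∫ ξ, ‖unitBall.indicator u (κ⁻¹ • ξ)‖ ^ 2 = κ ^ 3 * ∫ y in unitBall, ‖u y‖ ^ 2 := by
  have h := Measure.integral_comp_inv_smul (volume : Measure E3)
    (fun η => ‖unitBall.indicator u η‖ ^ 2) κ
  have h3 : Module.finrank ℝ E3 = 3 := by simp
  rw [h3, abs_of_pos (by positivity)] at h
  rw [h, smul_eq_mul, ← integral_indicator Metric.isClosed_closedBall.measurableSet]
  congr 2; funext η
  by_cases hη : η ∈ unitBall
  · simp [Set.indicator_of_mem hη]
  · simp [Set.indicator_of_notMem hη]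

/-- The scaled finite Fourier transform of `u` is the inverse `L²` Fourier transform of the
dilated extension of `u` by zero. -/
theorem exists_fourierInv_ae_eq_finiteFT {c : ℝ} (hc : 0 < c) {u : E3 → ℂ}
    (hu : MemLp u 2 (volume.restrict unitBall)) :
    ∃ hw : MemLp (fun ξ => unitBall.indicator u ((c / (2 * Real.pi))⁻¹ • ξ)) 2 volume,
      ((𝓕⁻ (hw.toLp _) : Lp (α := E3) ℂ 2 volume) : E3 → ℂ) =ᵐ[volume]
        fun x => (((c / (2 * Real.pi)) ^ 3 : ℝ) : ℂ) * finiteFT c u x := by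
  have hκ : 0 < c / (2 * Real.pi) := by positivity
  have hw := memLp_comp_inv_smul hκ (memLp_indicator_unitBall hu)
  have hw1 := memLp_comp_inv_smul hκ
    (memLp_indicator_unitBall (hu.mono_exponent (show (1 : ENNReal) ≤ 2 by norm_num)))
  refine ⟨hw, (coeFn_fourierInv_toLp hw (memLp_one_iff_integrable.1 hw1)).trans ?_⟩
  exact Filter.Eventually.of_forall fun x => fourierInv_dilate_indicator hc u x

theorem memLp_finiteFT {c : ℝ} (hc : 0 < c) {u : E3 → ℂ}
    (hu : MemLp u 2 (volume.restrict unitBall)) : MemLp (finiteFT c u) 2 volume := by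
  obtain ⟨hw, h⟩ := exists_fourierInv_ae_eq_finiteFT hc hu
  have h2 := ((memLp_congr_ae h).1 (Lp.memLp _)).const_mul
    ((((c / (2 * Real.pi)) ^ 3 : ℝ) : ℂ)⁻¹)
  have hne : (((c / (2 * Real.pi)) ^ 3 : ℝ) : ℂ) ≠ 0 :=
    Complex.ofReal_ne_zero.2 (by positivity)
  simpa only [inv_mul_cancel_left₀ hne] using! h2

/-- Plancherel for the finite Fourier transform. -/
theorem integral_norm_sq_finiteFT {c : ℝ} (hc : 0 < c) {u : E3 → ℂ}
    (hu : MemLp u 2 (volume.restrict unitBall)) :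
    (c / (2 * Real.pi)) ^ 3 * ∫ x, ‖finiteFT c u x‖ ^ 2 = ∫ y in unitBall, ‖u y‖ ^ 2 := by
  obtain ⟨hw, h⟩ := exists_fourierInv_ae_eq_finiteFT hc hu
  have hκ : 0 < c / (2 * Real.pi) := by positivity
  set κ := c / (2 * Real.pi)
  have h1 : ‖(𝓕⁻ (hw.toLp _) : Lp (α := E3) ℂ 2 volume)‖ = ‖hw.toLp _‖ := by
    rw [← Lp.norm_fourier_eq, FourierTransform.fourier_fourierInv_eq]
  have h2 := congrArg (· ^ 2) h1
  simp only [norm_toLp_sq, norm_Lp_sq (𝓕⁻ (hw.toLp _)), integral_norm_sq_dilate_indicator hκ] at h2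
  have h3 : ∫ x, ‖(𝓕⁻ (hw.toLp _) : Lp (α := E3) ℂ 2 volume) x‖ ^ 2 =
      (κ ^ 3) ^ 2 * ∫ x, ‖finiteFT c u x‖ ^ 2 := by
    rw [← integral_const_mul]
    refine integral_congr_ae ?_
    filter_upwards [h] with x hx
    rw [hx, norm_mul, mul_pow, Complex.norm_real, Real.norm_of_nonneg (by positivity)]
  rw [h3] at h2
  have : κ ^ 3 ≠ 0 := by positivity
  apply mul_left_cancel₀ this
  rw [← h2]; ring

/-! ### The band-limited part of `f` -/

theorem deltaC_nonneg (c : ℝ) (f : E3 → ℂ) (hf : MemLp f 2 volume) : 0 ≤ deltaC c f hf :=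
  mul_nonneg (by positivity) ENNReal.toReal_nonneg

theorem memLp_fourier (f : E3 → ℂ) (hf : MemLp f 2 volume) : MemLp (fourier f hf) 2 volume := by
  have h2π : 0 < 2 * Real.pi := by positivity
  exact memLp_comp_inv_smul h2π (Lp.memLp _)

theorem memLp_fourier_smul {c : ℝ} (hc : 0 < c) (f : E3 → ℂ) (hf : MemLp f 2 volume) :
    MemLp (fun ω => fourier f hf (c • ω)) 2 (volume.restrict unitBall) := by
  have h := memLp_comp_inv_smul (inv_pos.2 hc) (memLp_fourier f hf)
  simp only [inv_inv] at h
  exact h.restrict _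

/-- The squared normalization (2π)⁻³ cancels the Jacobian of ω ↦ ω/2π, which takes the ball of
radius c to that of radius c/2π. -/
theorem deltaC_sq (c : ℝ) (f : E3 → ℂ) (hf : MemLp f 2 volume) :
    deltaC c f hf ^ 2 = ∫ ξ in (ball (c / (2 * Real.pi)))ᶜ,
      ‖(𝓕 (hf.toLp f) : Lp (α := E3) ℂ 2 volume) ξ‖ ^ 2 := by
  have h2π : 0 < 2 * Real.pi := by positivity
  set F := (𝓕 (hf.toLp f) : Lp (α := E3) ℂ 2 volume)
  have h := Measure.integral_comp_inv_smul (volume : Measure E3)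
    ((ball (c / (2 * Real.pi)))ᶜ.indicator fun ξ => ‖F ξ‖ ^ 2) (2 * Real.pi)
  have h3 : Module.finrank ℝ E3 = 3 := by simp
  rw [h3, abs_of_pos (by positivity),
    integral_indicator Metric.isClosed_closedBall.measurableSet.compl] at h
  rw [deltaC, eLpNorm_two_eq_ofReal_sqrt ((memLp_fourier f hf).restrict _),
    ENNReal.toReal_ofReal (Real.sqrt_nonneg _), mul_pow,
    Real.sq_sqrt (integral_nonneg fun _ => by positivity)]
  have hI : ∫ ω in (ball c)ᶜ, ‖fourier f hf ω‖ ^ 2 =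
      ∫ ω : E3, (ball (c / (2 * Real.pi)))ᶜ.indicator (fun ξ => ‖F ξ‖ ^ 2)
        ((2 * Real.pi)⁻¹ • ω) := by
    rw [← integral_indicator Metric.isClosed_closedBall.measurableSet.compl]
    congr 1; funext ω
    have hmem : (2 * Real.pi)⁻¹ • ω ∈ ball (c / (2 * Real.pi)) ↔ ω ∈ ball c := by
      simp only [mem_closedBall_zero_iff, norm_smul, norm_inv, Real.norm_of_nonneg h2π.le]
      rw [inv_mul_eq_div, div_le_div_iff_of_pos_right h2π]
    by_cases hω : ω ∈ ball c
    · rw [Set.indicator_of_notMem (by simpa using hω),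
        Set.indicator_of_notMem (by simpa only [Set.mem_compl_iff, not_not] using hmem.2 hω)]
    · rw [Set.indicator_of_mem (by simpa using hω),
        Set.indicator_of_mem (by simpa only [Set.mem_compl_iff] using mt hmem.1 hω)]
      rfl
  rw [hI, h, smul_eq_mul, ← mul_assoc, ← Real.rpow_natCast, ← Real.rpow_mul h2π.le,
    ← Real.rpow_natCast, ← Real.rpow_add h2π]
  norm_num

/-- The band-limited part of `f` is a scaled finite Fourier transform. -/
theorem integral_norm_sq_sub_finiteFT {c : ℝ} (hc : 0 < c) {f : E3 → ℂ} (hf : MemLp f 2 volume) :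
    ∫ x, ‖f x - (((c / (2 * Real.pi)) ^ 3 : ℝ) : ℂ) *
      finiteFT c (fun ω => fourier f hf (c • ω)) x‖ ^ 2 = deltaC c f hf ^ 2 := by
  obtain ⟨hw, h⟩ := exists_fourierInv_ae_eq_finiteFT hc (memLp_fourier_smul hc f hf)
  rw [deltaC_sq]
  have hκ : 0 < c / (2 * Real.pi) := by positivity
  set F := (𝓕 (hf.toLp f) : Lp (α := E3) ℂ 2 volume) with hF
  -- The two dilations cancel, leaving the transform of `f` cut off to the ball of radius c/2π; its
  -- difference from the full transform is the part measured by δ_c.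
  have hwF : (fun ξ => unitBall.indicator (fun ω => fourier f hf (c • ω))
      ((c / (2 * Real.pi))⁻¹ • ξ)) = (ball (c / (2 * Real.pi))).indicator F := by
    funext ξ
    have hmem : (c / (2 * Real.pi))⁻¹ • ξ ∈ unitBall ↔ ξ ∈ ball (c / (2 * Real.pi)) := by
      simp only [mem_closedBall_zero_iff, norm_smul, norm_inv, Real.norm_of_nonneg hκ.le]
      rw [inv_mul_le_iff₀ hκ, mul_one]
    by_cases hξ : ξ ∈ ball (c / (2 * Real.pi))
    · rw [Set.indicator_of_mem hξ, Set.indicator_of_mem (hmem.2 hξ), fourier, smul_smul, smul_smul]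
      have : (2 * Real.pi)⁻¹ * c * (c / (2 * Real.pi))⁻¹ = 1 := by field_simp
      rw [this, one_smul]
    · rw [Set.indicator_of_notMem hξ, Set.indicator_of_notMem (mt hmem.1 hξ)]
  have hsub : ∀ a b : Lp (α := E3) ℂ 2 volume, 𝓕 (a - b) = 𝓕 a - 𝓕 b :=
    (Lp.fourierTransformₗᵢ E3 ℂ).map_sub
  have h1 : ‖hf.toLp f - (𝓕⁻ (hw.toLp _) : Lp (α := E3) ℂ 2 volume)‖ = ‖F - hw.toLp _‖ := by
    rw [← Lp.norm_fourier_eq, hsub, FourierTransform.fourier_fourierInv_eq]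
  have h2 := congrArg (· ^ 2) h1
  simp only [norm_Lp_sq] at h2
  rw [← integral_indicator Metric.isClosed_closedBall.measurableSet.compl]
  calc _ = _ := integral_congr_ae ?_
    _ = _ := h2
    _ = _ := integral_congr_ae ?_
  · filter_upwards [h, Lp.coeFn_sub (hf.toLp f) (𝓕⁻ (hw.toLp _)), hf.coeFn_toLp] with x h₁ h₂ h₃
    rw [h₂, Pi.sub_apply, h₁, h₃]
  · filter_upwards [Lp.coeFn_sub F (hw.toLp _), hw.coeFn_toLp] with x h₁ h₂
    rw [h₁, Pi.sub_apply, h₂, congrFun hwF x]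
    by_cases hx : x ∈ ball (c / (2 * Real.pi))
    · rw [Set.indicator_of_mem hx, Set.indicator_of_notMem (by simpa using hx)]
      simp
    · rw [Set.indicator_of_notMem hx, Set.indicator_of_mem (by simpa using hx)]
      simp

/-! ### Kernel estimates and the operator on `L²(R)` -/

theorem norm_kernel (c : ℝ) (x y : E3) :
    ‖Complex.exp (Complex.I * ((c * inner ℝ x y : ℝ) : ℂ))‖ = 1 := by
  rw [mul_comm, Complex.norm_exp_ofReal_mul_I]

theorem integrable_of_memLp {u : E3 → ℂ} (hu : MemLp u 2 (volume.restrict unitBall)) :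
    Integrable u (volume.restrict unitBall) :=
  memLp_one_iff_integrable.1 (hu.mono_exponent (by norm_num))

theorem memLp_kernel (c : ℝ) (x : E3) :
    MemLp (fun y => Complex.exp (Complex.I * ((c * inner ℝ x y : ℝ) : ℂ))) 2
      (volume.restrict unitBall) :=
  MemLp.of_bound (Continuous.aestronglyMeasurable (by fun_prop)) 1
    (Filter.Eventually.of_forall fun y => (norm_kernel c x y).le)

/-- The kernel of the finite Fourier transform of bandlimit `-c` as a vector of `L²(R)`. -/
noncomputable def kernelVec (c : ℝ) (x : E3) : Lp ℂ 2 ((volume : Measure E3).restrict unitBall) :=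
  (memLp_kernel (-c) x).toLp _

/-- The inner product conjugates its first argument, which is why the vector carries bandlimit `-c`.
Pointwise bounds on `finiteFT` thereby reduce to Cauchy–Schwarz. -/
theorem inner_kernelVec (c : ℝ) (x : E3) (u : Lp ℂ 2 ((volume : Measure E3).restrict unitBall)) :
    inner ℂ (kernelVec c x) u = finiteFT c u x := by
  rw [L2.inner_def, finiteFT]
  refine integral_congr_ae ?_
  filter_upwards [(memLp_kernel (-c) x).coeFn_toLp] with y hy
  rw [kernelVec, hy, RCLike.inner_apply, ← Complex.exp_conj, mul_comm]
  simp

theorem norm_kernelVec_sq (c : ℝ) (x : E3) :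
    ‖kernelVec c x‖ ^ 2 = (volume : Measure E3).real unitBall := by
  rw [kernelVec, norm_toLp_sq]
  simp only [norm_kernel]
  simp

/-- Factor out a unimodular exponential, then use |exp(it) - 1| ≤ |t| and ‖y‖ ≤ 1. -/
theorem norm_kernelVec_sub_le (c : ℝ) (x x' : E3) :
    ‖kernelVec c x - kernelVec c x'‖ ≤
      |c| * Real.sqrt ((volume : Measure E3).real unitBall) * ‖x - x'‖ := by
  refine le_of_sq_le_sq ?_ (by positivity)
  have h : kernelVec c x - kernelVec c x' =
      ((memLp_kernel (-c) x).sub (memLp_kernel (-c) x')).toLp _ := rfl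
  rw [h, norm_toLp_sq, mul_pow, mul_pow, Real.sq_sqrt measureReal_nonneg]
  have hb : ∀ y ∈ unitBall, ‖Complex.exp (Complex.I * ((-c * inner ℝ x y : ℝ) : ℂ)) -
      Complex.exp (Complex.I * ((-c * inner ℝ x' y : ℝ) : ℂ))‖ ^ 2 ≤ (|c| * ‖x - x'‖) ^ 2 := by
    intro y hy
    have hy1 : ‖y‖ ≤ 1 := by simpa using hy
    have e : Complex.exp (Complex.I * ((-c * inner ℝ x y : ℝ) : ℂ)) -
      Complex.exp (Complex.I * ((-c * inner ℝ x' y : ℝ) : ℂ)) =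
      Complex.exp (Complex.I * ((-c * inner ℝ x' y : ℝ) : ℂ)) *
        (Complex.exp (Complex.I * ((-c * inner ℝ (x - x') y : ℝ) : ℂ)) - 1) := by
      rw [mul_sub, ← Complex.exp_add, mul_one, inner_sub_left]
      congr 2
      push_cast; ring
    rw [e, norm_mul, norm_kernel, one_mul]
    gcongr
    refine (Real.norm_exp_I_mul_ofReal_sub_one_le).trans ?_
    rw [norm_mul, norm_neg, Real.norm_eq_abs]
    gcongr
    exact (norm_inner_le_norm _ _).trans (mul_le_of_le_one_right (norm_nonneg _) hy1)
  calc _ ≤ ∫ y in unitBall, (|c| * ‖x - x'‖) ^ 2 := by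
        refine setIntegral_mono_on ?_ (integrable_const _)
          Metric.isClosed_closedBall.measurableSet hb
        exact (((memLp_kernel (-c) x).sub (memLp_kernel (-c) x'))).integrable_norm_pow (by norm_num)
    _ = _ := by rw [setIntegral_const, smul_eq_mul]; ring

theorem norm_finiteFT_le (c : ℝ) (u : Lp ℂ 2 ((volume : Measure E3).restrict unitBall)) (x : E3) :
    ‖finiteFT c u x‖ ≤ Real.sqrt ((volume : Measure E3).real unitBall) * ‖u‖ := by
  rw [← inner_kernelVec, ← norm_kernelVec_sq c x, Real.sqrt_sq (norm_nonneg _)]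
  exact norm_inner_le_norm _ _

theorem norm_finiteFT_sub_le (c : ℝ) (u : Lp ℂ 2 ((volume : Measure E3).restrict unitBall))
    (x x' : E3) : ‖finiteFT c u x - finiteFT c u x'‖ ≤
      |c| * Real.sqrt ((volume : Measure E3).real unitBall) * ‖u‖ * ‖x - x'‖ := by
  rw [← inner_kernelVec, ← inner_kernelVec, ← inner_sub_left]
  refine (norm_inner_le_norm _ _).trans ?_
  calc _ ≤ |c| * Real.sqrt ((volume : Measure E3).real unitBall) * ‖x - x'‖ * ‖u‖ := by
        gcongr; exact norm_kernelVec_sub_le c x x'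
    _ = _ := by ring

theorem finiteFT_congr_ae {u v : E3 → ℂ} (h : u =ᵐ[volume.restrict unitBall] v) (c : ℝ) :
    finiteFT c u = finiteFT c v := by
  funext x
  refine integral_congr_ae ?_
  filter_upwards [h] with y hy
  rw [hy]

theorem continuous_finiteFT_Lp (c : ℝ) (u : Lp ℂ 2 ((volume : Measure E3).restrict unitBall)) :
    Continuous (finiteFT c u) := by
  refine (LipschitzWith.of_dist_le'
    (K := |c| * Real.sqrt ((volume : Measure E3).real unitBall) * ‖u‖) ?_).continuous
  intro x x'
  rw [dist_eq_norm, dist_eq_norm]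
  exact norm_finiteFT_sub_le c u x x'

theorem continuous_finiteFT (c : ℝ) {u : E3 → ℂ} (hu : MemLp u 2 (volume.restrict unitBall)) :
    Continuous (finiteFT c u) := by
  rw [← finiteFT_congr_ae hu.coeFn_toLp]
  exact continuous_finiteFT_Lp c _

theorem memLp_finiteFT_restrict (c : ℝ) (u : Lp ℂ 2 ((volume : Measure E3).restrict unitBall)) :
    MemLp (finiteFT c u) 2 (volume.restrict unitBall) :=
  MemLp.of_bound (continuous_finiteFT_Lp c u).aestronglyMeasurable _
    (Filter.Eventually.of_forall (norm_finiteFT_le c u))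

/-- The finite Fourier transform as an operator on `L²(R)`. -/
noncomputable def finiteFTOp (c : ℝ) : Lp ℂ 2 ((volume : Measure E3).restrict unitBall) →L[ℂ]
    Lp ℂ 2 ((volume : Measure E3).restrict unitBall) :=
  LinearMap.mkContinuous
    { toFun := fun u => (memLp_finiteFT_restrict c u).toLp _
      map_add' := fun u v => by
        rw [← MemLp.toLp_add]
        congr 1; funext x
        simp only [Pi.add_apply, ← inner_kernelVec, inner_add_right]
      map_smul' := fun a u => by
        rw [RingHom.id_apply, ← MemLp.toLp_const_smul]
        congr 1; funext x
        simp only [Pi.smul_apply, ← inner_kernelVec, inner_smul_right, smul_eq_mul] }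
    ((volume : Measure E3).real unitBall) (by
      intro u
      refine le_of_sq_le_sq ?_ (by positivity)
      simp only [LinearMap.coe_mk, AddHom.coe_mk]
      rw [norm_toLp_sq, mul_pow]
      calc _ ≤ ∫ y in unitBall, (Real.sqrt ((volume : Measure E3).real unitBall) * ‖u‖) ^ 2 := by
            refine integral_mono ((memLp_finiteFT_restrict c u).integrable_norm_pow (by norm_num))
              (integrable_const _) fun x => ?_
            exact pow_le_pow_left₀ (norm_nonneg _) (norm_finiteFT_le c u x) 2
        _ = _ := by
            rw [mul_pow, Real.sq_sqrt measureReal_nonneg]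
            simp; ring)

theorem coeFn_finiteFTOp (c : ℝ) (u : Lp ℂ 2 ((volume : Measure E3).restrict unitBall)) :
    finiteFTOp c u =ᵐ[volume.restrict unitBall] finiteFT c u :=
  (memLp_finiteFT_restrict c u).coeFn_toLp

/-! ### Compactness -/

open scoped BoundedContinuousFunction

/-- The retraction of space onto the unit ball. -/
noncomputable def unitBallRetraction : C(E3, unitBall) where
  toFun x := ⟨(max 1 ‖x‖)⁻¹ • x, by
    have h : 0 < max 1 ‖x‖ := lt_max_of_lt_left one_pos
    rw [mem_closedBall_zero_iff, norm_smul, norm_inv, Real.norm_of_nonneg h.le,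
      inv_mul_le_iff₀ h, mul_one]
    exact le_max_right _ _⟩
  continuous_toFun := by
    have h : Continuous fun x : E3 => max 1 ‖x‖ := by fun_prop
    exact ((h.inv₀ fun x => (lt_max_of_lt_left one_pos).ne').smul continuous_id).subtype_mk _

theorem unitBallRetraction_of_mem {x : E3} (hx : x ∈ unitBall) :
    (unitBallRetraction x : E3) = x := by
  have : max 1 ‖x‖ = 1 := max_eq_left (by simpa using hx)
  simp [unitBallRetraction, this]

/-- By Arzelà–Ascoli: the images of the unit ball of `L²(R)` are uniformly bounded with a common
Lipschitz constant, hence relatively compact in C(R), which maps continuously to `L²(R)`. -/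
theorem isCompactOperator_finiteFTOp (c : ℝ) : IsCompactOperator (finiteFTOp c) := by
  have hX : CompactSpace unitBall := isCompact_iff_compactSpace.1 (isCompact_closedBall _ _)
  let A : Set (unitBall →ᵇ ℂ) := {g | ∃ u : Lp ℂ 2 ((volume : Measure E3).restrict unitBall),
    ‖u‖ ≤ 1 ∧ ∀ x : unitBall, g x = finiteFT c u x}
  have hA : IsCompact (closure A) := by
    refine BoundedContinuousFunction.arzela_ascoli
      (Metric.closedBall 0 (Real.sqrt ((volume : Measure E3).real unitBall)))
      (isCompact_closedBall _ _) A ?_ ?_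
    · rintro g x ⟨u, hu, hg⟩
      rw [mem_closedBall_zero_iff, hg]
      exact (norm_finiteFT_le c u x).trans (mul_le_of_le_one_right (Real.sqrt_nonneg _) hu)
    · refine Metric.equicontinuous_of_continuity_modulus
        (fun t => |c| * Real.sqrt ((volume : Measure E3).real unitBall) * t) ?_ _ ?_
      · have : Continuous fun t : ℝ =>
          |c| * Real.sqrt ((volume : Measure E3).real unitBall) * t := by fun_prop
        simpa using! this.tendsto 0
      · rintro x y ⟨g, u, hu, hg⟩
        change dist (g x) (g y) ≤ _
        rw [hg, hg, dist_eq_norm, Subtype.dist_eq, dist_eq_norm]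
        refine (norm_finiteFT_sub_le c u x y).trans ?_
        exact mul_le_mul_of_nonneg_right (mul_le_of_le_one_right (by positivity) hu)
          (norm_nonneg _)
  -- Composition with the retraction extends a function on the ball to the whole space, where `toLp`
  -- for the restricted measure applies.
  let Φ : (unitBall →ᵇ ℂ) → Lp ℂ 2 ((volume : Measure E3).restrict unitBall) := fun g =>
    BoundedContinuousFunction.toLp 2 (volume.restrict unitBall) ℂ
      (g.compContinuous unitBallRetraction)
  have hΦ : Continuous Φ := (BoundedContinuousFunction.toLp (E := ℂ) 2 _ ℂ).continuous.comp
    (BoundedContinuousFunction.continuous_compContinuous _)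
  rw [← ContinuousLinearMap.coe_coe,
    isCompactOperator_iff_image_closedBall_subset_compact _ one_pos]
  refine ⟨Φ '' closure A, hA.image hΦ, ?_⟩
  rintro _ ⟨u, hu, rfl⟩
  have hu1 : ‖u‖ ≤ 1 := by simpa using hu
  refine ⟨BoundedContinuousFunction.mkOfCompact
    ⟨fun x : unitBall => finiteFT c u x, (continuous_finiteFT_Lp c u).comp continuous_subtype_val⟩,
    subset_closure ⟨u, hu1, fun x => rfl⟩, ?_⟩
  refine Lp.ext ?_
  refine (BoundedContinuousFunction.coeFn_toLp (p := 2) (𝕜 := ℂ) (volume.restrict unitBall)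
    _).trans (Filter.EventuallyEq.trans ?_ (coeFn_finiteFTOp c u).symm)
  filter_upwards [ae_restrict_mem Metric.isClosed_closedBall.measurableSet] with x hx
  simp [unitBallRetraction_of_mem hx]

/-! ### Reflection and the adjoint -/

theorem measurePreserving_neg_unitBall :
    MeasurePreserving (fun x : E3 => -x) (volume.restrict unitBall) (volume.restrict unitBall) := by
  have h := (Measure.measurePreserving_neg (volume : Measure E3)).restrict_preimage
    (s := unitBall) Metric.isClosed_closedBall.measurableSet
  have e : (Neg.neg : E3 → E3) ⁻¹' unitBall = unitBall := by ext; simp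
  rw [e] at h
  exact h

/-- The reflection `u ↦ u(-·)` on `L²(R)`. -/
noncomputable def reflection : Lp ℂ 2 ((volume : Measure E3).restrict unitBall) →L[ℂ]
    Lp ℂ 2 ((volume : Measure E3).restrict unitBall) :=
  (Lp.compMeasurePreservingₗᵢ ℂ _ measurePreserving_neg_unitBall).toContinuousLinearMap

theorem coeFn_reflection (u : Lp ℂ 2 ((volume : Measure E3).restrict unitBall)) :
    reflection u =ᵐ[volume.restrict unitBall] fun x => u (-x) :=
  Lp.coeFn_compMeasurePreserving u measurePreserving_neg_unitBall

theorem reflection_reflection (u : Lp ℂ 2 ((volume : Measure E3).restrict unitBall)) :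
    reflection (reflection u) = u := by
  refine Lp.ext ?_
  have h := measurePreserving_neg_unitBall.quasiMeasurePreserving.ae_eq_comp (coeFn_reflection u)
  filter_upwards [coeFn_reflection (reflection u), h] with x h1 h2
  simpa [h1] using! h2

theorem finiteFT_neg (c : ℝ) (u : E3 → ℂ) (x : E3) : finiteFT c u (-x) = finiteFT (-c) u x := by
  simp [finiteFT]

theorem finiteFT_reflection (c : ℝ) (u : Lp ℂ 2 ((volume : Measure E3).restrict unitBall))
    (x : E3) : finiteFT c (reflection u) x = finiteFT c u (-x) := by
  rw [finiteFT_congr_ae (coeFn_reflection u), finiteFT, finiteFT,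
    ← measurePreserving_neg_unitBall.integral_comp (Homeomorph.neg E3).measurableEmbedding]
  simp

theorem reflection_finiteFTOp (c : ℝ) (u : Lp ℂ 2 ((volume : Measure E3).restrict unitBall)) :
    reflection (finiteFTOp c u) = finiteFTOp (-c) u := by
  refine Lp.ext ?_
  have h := measurePreserving_neg_unitBall.quasiMeasurePreserving.ae_eq_comp (coeFn_finiteFTOp c u)
  filter_upwards [coeFn_reflection (finiteFTOp c u), h, coeFn_finiteFTOp (-c) u] with x h1 h2 h3
  rw [h1, h3, ← finiteFT_neg]
  exact h2

theorem finiteFTOp_reflection (c : ℝ) (u : Lp ℂ 2 ((volume : Measure E3).restrict unitBall)) :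
    finiteFTOp c (reflection u) = finiteFTOp (-c) u := by
  refine Lp.ext ?_
  filter_upwards [coeFn_finiteFTOp c (reflection u), coeFn_finiteFTOp (-c) u] with x h1 h2
  rw [h1, h2, finiteFT_reflection, finiteFT_neg]

/-- Fubini: the kernel is symmetric in x and y, so conjugation only changes the sign of c. -/
theorem inner_finiteFTOp_left (c : ℝ)
    (u v : Lp ℂ 2 ((volume : Measure E3).restrict unitBall)) :
    inner ℂ (finiteFTOp c u) v = inner ℂ u (finiteFTOp (-c) v) := by
  have hu := integrable_of_memLp (Lp.memLp u)
  have hv := integrable_of_memLp (Lp.memLp v)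
  rw [L2.inner_def, L2.inner_def]
  have h1 : ∫ x in unitBall, inner ℂ (finiteFTOp c u x) (v x) =
      ∫ x in unitBall, ∫ y in unitBall,
        Complex.exp (Complex.I * ((-c * inner ℝ x y : ℝ) : ℂ)) *
          (starRingEnd ℂ (u y) * v x) := by
    refine integral_congr_ae ?_
    filter_upwards [coeFn_finiteFTOp c u] with x hx
    rw [hx, RCLike.inner_apply, finiteFT, ← integral_conj, mul_comm, ← integral_mul_const]
    congr 1; funext y
    rw [map_mul, ← Complex.exp_conj, mul_assoc]
    simp
  have h2 : ∫ y in unitBall, inner ℂ (u y) (finiteFTOp (-c) v y) =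
      ∫ y in unitBall, ∫ x in unitBall,
        Complex.exp (Complex.I * ((-c * inner ℝ x y : ℝ) : ℂ)) *
          (starRingEnd ℂ (u y) * v x) := by
    refine integral_congr_ae ?_
    filter_upwards [coeFn_finiteFTOp (-c) v] with y hy
    rw [hy, RCLike.inner_apply, finiteFT, ← integral_mul_const]
    congr 1; funext x
    rw [real_inner_comm]; ring
  rw [h1, h2]
  refine integral_integral_swap ?_
  have hprod : Integrable (fun p : E3 × E3 => starRingEnd ℂ (u p.2) * v p.1)
      ((volume.restrict unitBall).prod (volume.restrict unitBall)) := by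
    have hu' : Integrable (fun y => starRingEnd ℂ (u y)) (volume.restrict unitBall) :=
      (LinearIsometryEquiv.integrable_comp_iff Complex.conjLIE).2 hu
    simpa only [mul_comm] using hv.mul_prod hu'
  exact hprod.bdd_mul (c := 1) (Continuous.aestronglyMeasurable (by fun_prop))
    (Filter.Eventually.of_forall fun p => (norm_kernel (-c) p.1 p.2).le)

/-! ### Analyticity and energy outside the ball -/

/-- Restricted to the line through 0 and x, the transform extends to an entire function `φ` of z. It
vanishes for large real z, hence identically, and z = 1 gives the value at x. -/
theorem finiteFT_eq_zero_of_forall_one_lt (c : ℝ) {u : E3 → ℂ}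
    (hu : Integrable u (volume.restrict unitBall)) (h : ∀ x, 1 < ‖x‖ → finiteFT c u x = 0)
    (x : E3) (hx : x ≠ 0) : finiteFT c u x = 0 := by
  let k : ℂ → E3 → ℂ := fun z y =>
    Complex.exp (z * (Complex.I * ((c * inner ℝ x y : ℝ) : ℂ))) * u y
  let k' : ℂ → E3 → ℂ := fun z y => (Complex.I * ((c * inner ℝ x y : ℝ) : ℂ)) *
    Complex.exp (z * (Complex.I * ((c * inner ℝ x y : ℝ) : ℂ))) * u y
  let φ : ℂ → ℂ := fun z => ∫ y in unitBall, k z y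
  have hw : ∀ y ∈ unitBall, ‖Complex.I * ((c * inner ℝ x y : ℝ) : ℂ)‖ ≤ |c| * ‖x‖ := by
    intro y hy
    have hy1 : ‖y‖ ≤ 1 := by simpa using hy
    rw [norm_mul, Complex.norm_I, one_mul, Complex.norm_real, norm_mul, Real.norm_eq_abs]
    gcongr
    exact (norm_inner_le_norm _ _).trans (mul_le_of_le_one_right (norm_nonneg _) hy1)
  have hexp : ∀ (z : ℂ), ∀ y ∈ unitBall,
      ‖Complex.exp (z * (Complex.I * ((c * inner ℝ x y : ℝ) : ℂ)))‖ ≤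
        Real.exp (‖z‖ * (|c| * ‖x‖)) := by
    intro z y hy
    rw [Complex.norm_exp]
    refine Real.exp_le_exp.2 ((Complex.re_le_norm _).trans ?_)
    rw [norm_mul]
    gcongr
    exact hw y hy
  have hφ : Differentiable ℂ φ := by
    intro z₀
    have hm : ∀ z, AEStronglyMeasurable (k z) (volume.restrict unitBall) := fun z =>
      (Continuous.aestronglyMeasurable (by fun_prop)).mul hu.aestronglyMeasurable
    have hint : Integrable (k z₀) (volume.restrict unitBall) := by
      refine hu.bdd_mul (c := Real.exp (‖z₀‖ * (|c| * ‖x‖)))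
        (Continuous.aestronglyMeasurable (by fun_prop)) ?_
      filter_upwards [ae_restrict_mem Metric.isClosed_closedBall.measurableSet] with y hy
      exact hexp z₀ y hy
    have hm' : AEStronglyMeasurable (k' z₀) (volume.restrict unitBall) :=
      (Continuous.aestronglyMeasurable (by fun_prop)).mul hu.aestronglyMeasurable
    refine (hasDerivAt_integral_of_dominated_loc_of_deriv_le (F := k) (F' := k')
      (bound := fun y => |c| * ‖x‖ * Real.exp ((‖z₀‖ + 1) * (|c| * ‖x‖)) * ‖u y‖)
      (Metric.ball_mem_nhds z₀ one_pos) (Filter.Eventually.of_forall hm) hint hm' ?_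
      (hu.norm.const_mul _) ?_).2.differentiableAt
    · filter_upwards [ae_restrict_mem Metric.isClosed_closedBall.measurableSet] with y hy z hz
      have hz1 : ‖z‖ ≤ ‖z₀‖ + 1 := by
        have h1 : ‖z - z₀‖ < 1 := by simpa [dist_eq_norm] using hz
        linarith [norm_le_norm_add_norm_sub z₀ z, norm_sub_rev z₀ z]
      rw [norm_mul, norm_mul]
      gcongr
      · exact hw y hy
      · exact (hexp z y hy).trans (by gcongr)
    · refine Filter.Eventually.of_forall fun y z _ => ?_
      have h1 := (((hasDerivAt_id z).mul_const
        (Complex.I * ((c * inner ℝ x y : ℝ) : ℂ))).cexp).mul_const (u y)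
      convert! h1 using 1
      simp only [k', id, one_mul]; ring
  have hφr : ∀ t : ℝ, φ t = finiteFT c u (t • x) := by
    intro t
    refine integral_congr_ae (Filter.Eventually.of_forall fun y => ?_)
    simp only [k]
    congr 2
    rw [inner_smul_left]
    push_cast
    simp
    ring
  have hzero : φ = 0 := by
    have hx0 : 0 < ‖x‖ := norm_pos_iff.2 hx
    -- Real t > 2/‖x‖ put t x outside the ball, so the zeros of `φ` accumulate at 2/‖x‖.
    refine AnalyticOnNhd.eq_of_frequently_eq (z₀ := ((2 / ‖x‖ : ℝ) : ℂ))
      (fun z _ => hφ.analyticAt z) (fun z _ => analyticAt_const) ?_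
    have ht : Filter.Tendsto (fun t : ℝ => (t : ℂ)) (nhdsWithin (2 / ‖x‖) (Set.Ioi (2 / ‖x‖)))
        (nhdsWithin ((2 / ‖x‖ : ℝ) : ℂ) {((2 / ‖x‖ : ℝ) : ℂ)}ᶜ) := by
      refine tendsto_nhdsWithin_of_tendsto_nhds_of_eventually_within _
        (Complex.continuous_ofReal.continuousAt.tendsto.mono_left nhdsWithin_le_nhds) ?_
      filter_upwards [self_mem_nhdsWithin] with t ht
      exact fun he => (Set.mem_Ioi.1 ht).ne' (Complex.ofReal_injective he)
    refine ht.frequently (Filter.Eventually.frequently ?_)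
    filter_upwards [self_mem_nhdsWithin] with t ht
    rw [hφr]
    refine h _ ?_
    have h2 := Set.mem_Ioi.1 ht
    have ht0 : 0 < t := lt_trans (by positivity) h2
    rw [norm_smul, Real.norm_of_nonneg ht0.le]
    rw [div_lt_iff₀ hx0] at h2
    linarith
  have := hφr 1
  rw [hzero] at this
  simpa using this.symm

/-- If the integral were zero, continuity would make the transform vanish at every exterior point,
hence everywhere except possibly at 0; Plancherel would then give u zero norm. -/
theorem setIntegral_compl_pos {c : ℝ} (hc : 0 < c) {u : E3 → ℂ}
    (hu : MemLp u 2 (volume.restrict unitBall)) (hne : 0 < ∫ y in unitBall, ‖u y‖ ^ 2) :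
    0 < ∫ x in unitBallᶜ, ‖finiteFT c u x‖ ^ 2 := by
  have hG := memLp_finiteFT hc hu
  have hcont := continuous_finiteFT c hu
  have hopen : IsOpen (unitBallᶜ : Set E3) := Metric.isClosed_closedBall.isOpen_compl
  refine (integral_nonneg fun _ => by positivity).lt_of_ne fun h0 => ?_
  have hae := (integral_eq_zero_iff_of_nonneg (fun _ => by positivity)
    ((hG.restrict unitBallᶜ).integrable_norm_pow (by norm_num))).1 h0.symm
  have hEq := Measure.eqOn_open_of_ae_eq hae hopen (by fun_prop) continuousOn_const
  have hz : ∀ x, 1 < ‖x‖ → finiteFT c u x = 0 := by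
    intro x hx
    have := hEq (show x ∈ (unitBallᶜ : Set E3) by simpa using hx)
    simpa using this
  have hz2 := finiteFT_eq_zero_of_forall_one_lt c (integrable_of_memLp hu) hz
  have hall : (fun x => ‖finiteFT c u x‖ ^ 2) =ᵐ[volume] 0 := by
    filter_upwards [compl_mem_ae_iff.2 (measure_singleton (0 : E3))] with x hx
    simp [hz2 x hx]
  rw [← integral_norm_sq_finiteFT hc hu, integral_congr_ae hall] at hne
  simp at hne

/-! ### Compact normal operators and truncated expansions -/

section Abstract

variable {H : Type*} [NormedAddCommGroup H] [InnerProductSpace ℂ H]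

/-- A compact symmetric operator vanishes on an invariant closed subspace that contains no
eigenvector with nonzero eigenvalue. -/
theorem apply_eq_zero_of_isCompactOperator [CompleteSpace H] {A : H →L[ℂ] H}
    (hA : IsCompactOperator A)
    (hsymm : ∀ u v, inner ℂ (A u) v = inner ℂ u (A v)) {V : Submodule ℂ H}
    (hVc : IsClosed (V : Set H)) (hV : ∀ v ∈ V, A v ∈ V)
    (heig : ∀ (μ : ℂ), μ ≠ 0 → ∀ v ∈ V, A v = μ • v → v = 0) (v : H) (hv : v ∈ V) : A v = 0 := by
  have : CompleteSpace V := hVc.completeSpace_coe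
  let B : V →L[ℂ] V := A.restrict hV
  have hBA : ∀ w : V, ((B w : V) : H) = A w := fun w => rfl
  have hBc : IsCompactOperator B := hA.restrict' (f := (A : H →ₗ[ℂ] H)) hV
  have hBs : B.IsSymmetric := fun u w => hsymm u w
  have hB : B = 0 := by
    rw [← ContinuousLinearMap.eq_zero_of_forall_hasEigenvalue_eq_zero hBc hBs]
    intro μ hμ
    by_contra hne
    obtain ⟨w, hw⟩ := hμ.exists_hasEigenvector
    refine hw.2 (Subtype.ext (heig μ hne w w.2 ?_))
    have h1 := congrArg (Subtype.val) hw.apply_eq_smul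
    simpa using! h1
  have h1 := hBA ⟨v, hv⟩
  rw [hB] at h1
  simpa using h1.symm

variable {T S : H →L[ℂ] H}

/-- Here T* = S T commutes with T. So z = T*w - āw is again killed by T - a, and ‖z‖² = ⟨w, (T -
a)z⟩ = 0. -/
theorem adjoint_apply_eigenvector (hST : ∀ u, S (T u) = T (S u))
    (hadj : ∀ u v, inner ℂ (T u) v = inner ℂ u (S (T v))) {w : H} {a : ℂ} (hw : T w = a • w) :
    S (T w) = starRingEnd ℂ a • w := by
  have hadj' : ∀ u v, inner ℂ (S (T u)) v = inner ℂ u (T v) := fun u v => by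
    rw [← inner_conj_symm, ← hadj, inner_conj_symm]
  rw [← sub_eq_zero, ← inner_self_eq_zero (𝕜 := ℂ)]
  have h0 : T (S (T w) - starRingEnd ℂ a • w) - a • (S (T w) - starRingEnd ℂ a • w) = 0 := by
    rw [map_sub, map_smul, ← hST, hw, map_smul, map_smul, hw, map_smul]
    simp only [smul_sub, smul_smul, mul_comm]
    abel
  have h1 : ∀ z, inner ℂ (S (T w) - starRingEnd ℂ a • w) z = inner ℂ w (T z - a • z) := by
    intro z
    rw [inner_sub_left, hadj', inner_smul_left, inner_sub_right, inner_smul_right,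
      Complex.conj_conj]
  rw [h1, h0, inner_zero_right]

/-- The eigenvectors of a compact normal operator `T` whose adjoint is `S T`, with `S` a commuting
involution, are complete as soon as no eigenvector is orthogonal to all of them. -/
theorem eq_zero_of_forall_inner_eigenvector [CompleteSpace H] (hT : IsCompactOperator T)
    (hS : ∀ u, S (S u) = u) (hST : ∀ u, S (T u) = T (S u))
    (hadj : ∀ u v, inner ℂ (T u) v = inner ℂ u (S (T v)))
    {ι : Type*} {e : ι → H} {a : ι → ℂ} (he : ∀ i, T (e i) = a i • e i)
    (hex : ∀ (μ : ℂ) (v : H), T v = μ • v → (∀ i, inner ℂ (e i) v = 0) → v = 0)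
    (v : H) (hv : ∀ i, inner ℂ (e i) v = 0) : v = 0 := by
  have hadj' : ∀ u v, inner ℂ (S (T u)) v = inner ℂ u (T v) := fun u v => by
    rw [← inner_conj_symm, ← hadj, inner_conj_symm]
  let V : Submodule ℂ H := (Submodule.span ℂ (Set.range e))ᗮ
  have hmem : ∀ v, v ∈ V ↔ ∀ i, inner ℂ (e i) v = 0 := by
    intro v
    rw [Submodule.mem_orthogonal]
    refine ⟨fun h i => h _ (Submodule.subset_span ⟨i, rfl⟩), fun h u hu => ?_⟩
    induction hu using Submodule.span_induction with
    | mem x hx => obtain ⟨i, rfl⟩ := hx; exact h i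
    | zero => simp
    | add x y _ _ hx hy => rw [inner_add_left, hx, hy, add_zero]
    | smul r x _ hx => rw [inner_smul_left, hx, mul_zero]
  have hVc : IsClosed (V : Set H) := Submodule.isClosed_orthogonal _
  have hVT : ∀ v ∈ V, T v ∈ V := by
    intro v hv
    rw [hmem] at hv ⊢
    intro i
    rw [← hadj', adjoint_apply_eigenvector hST hadj (he i), inner_smul_left, hv, mul_zero]
  have hVT' : ∀ v ∈ V, S (T v) ∈ V := by
    intro v hv
    rw [hmem] at hv ⊢
    intro i
    rw [← hadj, he, inner_smul_left, hv, mul_zero]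
  have hSTc : IsCompactOperator (S ∘L T) := hT.clm_comp S
  have hI : Complex.I ≠ 0 := Complex.I_ne_zero
  -- T + T* is symmetric and commutes with S. Its image is fixed by S, so an eigenvector with μ ≠ 0
  -- is S-even; there T* = T, which makes it an eigenvector of T for μ/2, excluded on `V`.
  have hplus : ∀ v ∈ V, T v + S (T v) = 0 := by
    refine apply_eq_zero_of_isCompactOperator (A := T + S ∘L T) (hT.add hSTc) ?_ hVc
      (fun v hv => V.add_mem (hVT v hv) (hVT' v hv)) ?_
    · intro u v
      simp only [add_apply, ContinuousLinearMap.comp_apply, inner_add_left,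
        inner_add_right, hadj, hadj']
      ring
    · intro μ hμ v hv hAv
      simp only [add_apply, ContinuousLinearMap.comp_apply] at hAv
      have hSv : S v = v := by
        have h1 := congrArg S hAv
        rw [map_add, hS, map_smul, add_comm, hAv] at h1
        exact (smul_right_injective H hμ h1).symm
      rw [hST, hSv, ← two_smul ℂ] at hAv
      refine hex (2⁻¹ * μ) v ?_ ((hmem v).1 hv)
      rw [mul_smul, ← hAv, smul_smul, inv_mul_cancel₀ two_ne_zero, one_smul]
  -- The same for i(T - T*): its eigenvectors with μ ≠ 0 are S-odd, where T* = -T, so the eigenvalue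
  -- of T is μ/(2i).
  have hminus : ∀ v ∈ V, Complex.I • (T v - S (T v)) = 0 := by
    refine apply_eq_zero_of_isCompactOperator (A := Complex.I • (T - S ∘L T))
      ((hT.sub hSTc).smul Complex.I) ?_ hVc
      (fun v hv => V.smul_mem _ (V.sub_mem (hVT v hv) (hVT' v hv))) ?_
    · intro u v
      simp only [smul_apply, sub_apply,
        ContinuousLinearMap.comp_apply, inner_sub_left, inner_smul_left, inner_smul_right,
        inner_sub_right, hadj, hadj', Complex.conj_I]
      ring
    · intro μ hμ v hv hAv
      simp only [smul_apply, sub_apply,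
        ContinuousLinearMap.comp_apply] at hAv
      have hSv : S v = -v := by
        have h1 := congrArg S hAv
        rw [map_smul, map_sub, hS, map_smul, ← neg_sub, smul_neg, hAv, ← smul_neg] at h1
        exact (smul_right_injective H hμ h1).symm
      rw [hST, hSv, map_neg, sub_neg_eq_add, ← two_smul ℂ, smul_smul] at hAv
      refine hex ((Complex.I * 2)⁻¹ * μ) v ?_ ((hmem v).1 hv)
      rw [mul_smul, ← hAv, smul_smul, inv_mul_cancel₀ (mul_ne_zero hI two_ne_zero), one_smul]
  have hvV := (hmem v).2 hv
  -- Both parts vanish, so T v = 0 and v is itself an excluded eigenvector, for the eigenvalue 0.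
  refine hex 0 v ?_ hv
  have h1 := hplus v hvV
  have h2 := sub_eq_zero.1 ((smul_eq_zero.1 (hminus v hvV)).resolve_left hI)
  rw [← h2, ← two_smul ℂ] at h1
  rw [zero_smul]
  exact (smul_eq_zero.1 h1).resolve_left two_ne_zero

theorem hasSum_norm_inner_sq {ι : Type*} (b : HilbertBasis ι ℂ H) (v : H) :
    HasSum (fun i => ‖inner ℂ (b i) v‖ ^ 2) (‖v‖ ^ 2) := by
  have h := (b.hasSum_inner_mul_inner v v).mapL Complex.reCLM
  have e : Complex.reCLM (inner ℂ v v) = ‖v‖ ^ 2 := by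
    rw [inner_self_eq_norm_sq_to_K]; norm_cast
  rw [e] at h
  convert! h using 1
  funext i
  rw [← inner_conj_symm v, ← Complex.normSq_eq_conj_mul_self,
    Complex.reCLM_apply, Complex.ofReal_re, Complex.normSq_eq_norm_sq]

/-- Truncation error of an eigenfunction expansion. -/
theorem norm_sq_apply_sub_sum_le {ι : Type*} (b : HilbertBasis ι ℂ H) {a : ι → ℂ}
    (hba : ∀ i v, inner ℂ (b i) (T v) = a i * inner ℂ (b i) v) (P : Finset ι) {k M : ℝ}
    (hM : 0 ≤ M) (hk : ∀ i, ‖a i‖ ^ 2 ≤ k)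
    (hP : ∀ i, i ∉ P → ‖a i‖ ^ 2 ≤ M * (k - ‖a i‖ ^ 2)) (h : H) :
    ‖T (h - ∑ i ∈ P, inner ℂ (b i) h • b i)‖ ^ 2 ≤ M * (k * ‖h‖ ^ 2 - ‖T h‖ ^ 2) := by
  classical
  have h1 := hasSum_norm_inner_sq b (T (h - ∑ i ∈ P, inner ℂ (b i) h • b i))
  have h2 := (((hasSum_norm_inner_sq b h).mul_left k).sub
    (hasSum_norm_inner_sq b (T h))).mul_left M
  -- Parseval on both sides: indices in `P` contribute zero on the left, the others are compared by
  -- `hP`.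
  refine hasSum_le (fun i => ?_) h1 h2
  rw [hba, hba, norm_mul, norm_mul, mul_pow, mul_pow, ← sub_mul]
  by_cases hi : i ∈ P
  · have h0 : inner ℂ (b i) (h - ∑ i ∈ P, inner ℂ (b i) h • b i) = 0 := by
      rw [inner_sub_right, b.orthonormal.inner_right_sum _ hi, sub_self]
    rw [h0, norm_zero]
    have := hk i
    have : 0 ≤ k - ‖a i‖ ^ 2 := by linarith
    simp only [ne_eq, OfNat.ofNat_ne_zero, not_false_eq_true, zero_pow, mul_zero]
    positivity
  · have h0 : inner ℂ (b i) (h - ∑ i ∈ P, inner ℂ (b i) h • b i) = inner ℂ (b i) h := by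
      rw [inner_sub_right, inner_sum, Finset.sum_eq_zero, sub_zero]
      intro j hj
      have hij : i ≠ j := fun hij => hi (hij ▸ hj)
      rw [inner_smul_right, b.orthonormal.2 hij, mul_zero]
    rw [h0, ← mul_assoc]
    exact mul_le_mul_of_nonneg_right (hP i hi) (by positivity)

end Abstract

/-! ### The prolate functions as a Hilbert basis, and their eigenvalues -/

variable {c : ℝ} {ψ : Index → E3 → ℂ} {α : ℕ → ℕ → ℂ}

theorem SolvesEigenEq.mul_eq {μ : ℂ} {φ : E3 → ℂ} (h : SolvesEigenEq c μ φ) {x : E3}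
    (hx : x ∈ unitBall) : μ * φ x = finiteFT c φ x := h.eq x hx

theorem subset_closure_interior_unitBall : unitBall ⊆ closure (interior unitBall) := by
  rw [interior_closedBall _ one_ne_zero, closure_ball _ one_ne_zero]

/-- An eigenvector of the operator on `L²(R)` has a representative solving the equation at every
point. -/
theorem exists_solvesEigenEq {μ : ℂ} {v : Lp ℂ 2 ((volume : Measure E3).restrict unitBall)}
    (hv : finiteFTOp c v = μ • v) :
    ∃ φ, φ =ᵐ[volume.restrict unitBall] v ∧ SolvesEigenEq c μ φ := by
  have hae : finiteFT c v =ᵐ[volume.restrict unitBall] fun x => μ * v x := by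
    filter_upwards [coeFn_finiteFTOp c v, Lp.coeFn_smul μ v] with x h1 h2
    rw [← h1, hv, h2, Pi.smul_apply, smul_eq_mul]
  -- For μ ≠ 0 the representative is μ⁻¹ times the transform. For μ = 0 any representative works,
  -- since the continuous transform vanishes a.e. on the ball and therefore at all its points.
  by_cases hμ : μ = 0
  · subst hμ
    refine ⟨v, Filter.EventuallyEq.rfl, Lp.memLp v, fun x hx => ?_⟩
    have hz : finiteFT c v =ᵐ[volume.restrict unitBall] fun _ => 0 := by simpa using hae
    have h0 := Measure.eqOn_of_ae_eq hz (continuous_finiteFT_Lp c v).continuousOn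
      continuousOn_const subset_closure_interior_unitBall hx
    rw [zero_mul]
    exact h0.symm
  · have hφ : (fun x => μ⁻¹ * finiteFT c v x) =ᵐ[volume.restrict unitBall] v := by
      filter_upwards [hae] with x hx
      rw [hx, inv_mul_cancel_left₀ hμ]
    refine ⟨_, hφ, (memLp_congr_ae hφ).2 (Lp.memLp v), fun x _ => ?_⟩
    change _ = finiteFT c (fun x => μ⁻¹ * finiteFT c v x) x
    rw [finiteFT_congr_ae hφ, mul_inv_cancel_left₀ hμ]

namespace IsSystem

theorem inner_toLp (hψ : IsSystem c ψ α) (i : Index) {φ : E3 → ℂ}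
    (hφ : MemLp φ 2 (volume.restrict unitBall)) :
    inner ℂ ((hψ.eigen i).memLp.toLp (ψ i)) (hφ.toLp φ) =
      ∫ x in unitBall, φ x * starRingEnd ℂ (ψ i x) := by
  rw [L2.inner_def]
  refine integral_congr_ae ?_
  filter_upwards [(hψ.eigen i).memLp.coeFn_toLp, hφ.coeFn_toLp] with x h1 h2
  rw [h1, h2, RCLike.inner_apply]

theorem orthonormal (hψ : IsSystem c ψ α) :
    Orthonormal ℂ fun i => (hψ.eigen i).memLp.toLp (ψ i) := by
  refine ⟨fun i => ?_, fun i j hij => ?_⟩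
  · rw [← sq_eq_sq₀ (norm_nonneg _) zero_le_one, norm_toLp_sq, hψ.normalized, one_pow]
  · exact (hψ.inner_toLp i (hψ.eigen j).memLp).trans (hψ.orthogonal j i hij.symm)

theorem finiteFTOp_toLp (hψ : IsSystem c ψ α) (i : Index) :
    finiteFTOp c ((hψ.eigen i).memLp.toLp (ψ i)) =
    α i.N i.n • (hψ.eigen i).memLp.toLp (ψ i) := by
  refine Lp.ext ?_
  filter_upwards [coeFn_finiteFTOp c ((hψ.eigen i).memLp.toLp (ψ i)),
    Lp.coeFn_smul (α i.N i.n) ((hψ.eigen i).memLp.toLp (ψ i)), (hψ.eigen i).memLp.coeFn_toLp,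
    ae_restrict_mem Metric.isClosed_closedBall.measurableSet] with x h1 h2 h3 hx
  rw [h1, h2, Pi.smul_apply, h3, smul_eq_mul, (hψ.eigen i).mul_eq hx,
    finiteFT_congr_ae (hψ.eigen i).memLp.coeFn_toLp]

theorem orthogonal_span_eq_bot (hψ : IsSystem c ψ α) :
    (Submodule.span ℂ (Set.range fun i => (hψ.eigen i).memLp.toLp (ψ i)))ᗮ = ⊥ := by
  rw [Submodule.eq_bot_iff]
  intro v hv
  refine eq_zero_of_forall_inner_eigenvector (isCompactOperator_finiteFTOp c)
    (S := reflection) reflection_reflection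
    (fun u => by rw [reflection_finiteFTOp, finiteFTOp_reflection])
    (fun u v => by rw [reflection_finiteFTOp, inner_finiteFTOp_left]) hψ.finiteFTOp_toLp ?_ v
    fun i => (Submodule.mem_orthogonal _ v).1 hv _ (Submodule.subset_span ⟨i, rfl⟩)
  intro μ w hw horth
  obtain ⟨φ, hφ, hsol⟩ := exists_solvesEigenEq hw
  have h0 := hψ.exhaustive μ φ hsol fun i => by
    rw [← hψ.inner_toLp i hsol.memLp, ← horth i]
    congr 1
    refine Lp.ext ?_
    exact hsol.memLp.coeFn_toLp.trans hφ
  refine Lp.ext ?_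
  filter_upwards [hφ, h0, Lp.coeFn_zero ℂ 2 ((volume : Measure E3).restrict unitBall)]
    with x h1 h2 h3
  rw [← h1, h2, h3, Pi.zero_apply]

/-- The prolate functions as a Hilbert basis of `L²(R)`. -/
noncomputable def hilbertBasis (hψ : IsSystem c ψ α) :
    HilbertBasis Index ℂ (Lp ℂ 2 ((volume : Measure E3).restrict unitBall)) :=
  HilbertBasis.mkOfOrthogonalEqBot hψ.orthonormal hψ.orthogonal_span_eq_bot

theorem hilbertBasis_apply (hψ : IsSystem c ψ α) (i : Index) :
    hψ.hilbertBasis i = (hψ.eigen i).memLp.toLp (ψ i) := by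
  rw [hilbertBasis, HilbertBasis.coe_mkOfOrthogonalEqBot]

/-- Normality enters here: the basis vectors are also eigenvectors of the adjoint, for the conjugate
eigenvalues. -/
theorem inner_hilbertBasis_finiteFTOp (hψ : IsSystem c ψ α) (i : Index)
    (v : Lp ℂ 2 ((volume : Measure E3).restrict unitBall)) :
    inner ℂ (hψ.hilbertBasis i) (finiteFTOp c v) =
      α i.N i.n * inner ℂ (hψ.hilbertBasis i) v := by
  rw [hilbertBasis_apply, ← inner_conj_symm, inner_finiteFTOp_left, inner_conj_symm,
    ← reflection_finiteFTOp, adjoint_apply_eigenvector (T := finiteFTOp c) (S := reflection)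
      (fun u => by rw [reflection_finiteFTOp, finiteFTOp_reflection])
      (fun u v => by rw [reflection_finiteFTOp, inner_finiteFTOp_left]) (hψ.finiteFTOp_toLp i),
    inner_smul_left, Complex.conj_conj]

theorem integral_norm_sq_finiteFT (hψ : IsSystem c ψ α) (i : Index) :
    ∫ x in unitBall, ‖finiteFT c (ψ i) x‖ ^ 2 = ‖α i.N i.n‖ ^ 2 := by
  rw [setIntegral_congr_fun (g := fun x => ‖α i.N i.n‖ ^ 2 * ‖ψ i x‖ ^ 2)
    Metric.isClosed_closedBall.measurableSet fun x hx => ?_, integral_const_mul, hψ.normalized,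
    mul_one]
  simp only
  rw [← (hψ.eigen i).mul_eq hx, norm_mul, mul_pow]

/-- By Plancherel α̃ is the fraction of the energy of T ψ that lies in R; the rest is positive. -/
theorem alphaTilde_lt_one (hψ : IsSystem c ψ α) (hc : 0 < c) (N n : ℕ) :
    alphaTilde c α N n < 1 := by
  let i : Index := ⟨N, 0, n, by simp, by simp⟩
  have hm := (hψ.eigen i).memLp
  have h1 := GPSWF.integral_norm_sq_finiteFT hc hm
  have h2 := setIntegral_compl_pos hc hm (by rw [hψ.normalized]; exact one_pos)
  have h3 := integral_add_compl (μ := volume) (s := unitBall)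
    Metric.isClosed_closedBall.measurableSet
    ((memLp_finiteFT hc hm).integrable_norm_pow (by norm_num))
  have h4 := hψ.integral_norm_sq_finiteFT i
  rw [hψ.normalized] at h1
  have hκ : 0 < (c / (2 * Real.pi)) ^ 3 := by positivity
  have h5 : alphaTilde c α N n = (c / (2 * Real.pi)) ^ 3 * ‖α i.N i.n‖ ^ 2 := rfl
  rw [h5, ← h4, ← h1]
  refine mul_lt_mul_of_pos_left ?_ hκ
  rw [← h3]
  exact lt_add_of_pos_right _ h2

/-- A Hilbert–Schmidt bound: Bessel's inequality for the kernel at fixed x, integrated over x in R.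
-/
theorem sum_norm_sq_le (hψ : IsSystem c ψ α) (F : Finset Index) :
    ∑ i ∈ F, ‖α i.N i.n‖ ^ 2 ≤ (volume : Measure E3).real unitBall ^ 2 := by
  have hG : ∀ i, Integrable (fun x => ‖finiteFT c (ψ i) x‖ ^ 2) (volume.restrict unitBall) := by
    intro i
    rw [← finiteFT_congr_ae (hψ.eigen i).memLp.coeFn_toLp]
    exact (memLp_finiteFT_restrict c _).integrable_norm_pow (by norm_num)
  simp_rw [← hψ.integral_norm_sq_finiteFT]
  rw [← integral_finsetSum _ fun i _ => hG i]
  calc _ ≤ ∫ _x in unitBall, (volume : Measure E3).real unitBall := by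
        refine integral_mono (integrable_finsetSum _ fun i _ => hG i) (integrable_const _)
          fun x => ?_
        have h := hψ.orthonormal.sum_inner_products_le (s := F) (kernelVec c x)
        rw [norm_kernelVec_sq] at h
        refine le_trans (le_of_eq (Finset.sum_congr rfl fun i _ => ?_)) h
        rw [norm_inner_symm, inner_kernelVec, finiteFT_congr_ae (hψ.eigen i).memLp.coeFn_toLp]
    _ = _ := by rw [setIntegral_const, smul_eq_mul, sq]

theorem tendsto_norm_sq (hψ : IsSystem c ψ α) :
    Filter.Tendsto (fun i : Index => ‖α i.N i.n‖ ^ 2) Filter.cofinite (nhds 0) :=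
  (summable_of_sum_le (fun _ => by positivity) hψ.sum_norm_sq_le).tendsto_cofinite_zero

end IsSystem

/-! ### Attainment of the maximum and the error estimate -/

instance : Infinite Index :=
  Infinite.of_injective (fun n : ℕ => (⟨0, 0, n, by simp, by simp⟩ : Index)) fun a b h => by
    simpa using congrArg Index.n h

/-- A nonnegative function tending to zero along the cofinite filter attains its maximum on a
nonempty set. -/
theorem exists_isMaxOn_of_tendsto_cofinite {ι : Type*} {t : ι → ℝ} (ht : ∀ i, 0 ≤ t i)
    (h : Filter.Tendsto t Filter.cofinite (nhds 0)) {s : Set ι} (hs : s.Nonempty) :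
    ∃ i ∈ s, ∀ j ∈ s, t j ≤ t i := by
  by_cases hpos : ∃ i ∈ s, 0 < t i
  · obtain ⟨i, hi, hti⟩ := hpos
    -- Only finitely many indices reach the positive value `t i`, so the maximum is taken among
    -- them.
    have hfin : {j | ¬ t j < t i}.Finite := h.eventually_lt_const hti
    obtain ⟨k, hk, hmax⟩ := Set.exists_max_image ({j | ¬ t j < t i} ∩ s) t
      (hfin.inter_of_left s) ⟨i, by simp, hi⟩
    refine ⟨k, hk.2, fun j hj => ?_⟩
    by_cases hji : t j < t i
    · exact hji.le.trans (not_lt.1 hk.1)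
    · exact hmax j ⟨hji, hj⟩
  · push Not at hpos
    obtain ⟨i, hi⟩ := hs
    exact ⟨i, hi, fun j hj => (hpos j hj).trans (ht i)⟩

/-- The energy outside the unit ball of the band-limited part of `f`. -/
theorem sqrt_setIntegral_compl_le {c : ℝ} (hc : 0 < c) {f : E3 → ℂ} (hf : MemLp f 2 volume)
    {ε : ℝ} (hε : 0 ≤ ε)
    (hconc : eLpNorm (unitBallᶜ.indicator f) 2 volume ≤ ENNReal.ofReal ε) :
    Real.sqrt (∫ x in unitBallᶜ, ‖(((c / (2 * Real.pi)) ^ 3 : ℝ) : ℂ) *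
      finiteFT c (fun ω => fourier f hf (c • ω)) x‖ ^ 2) ≤ ε + deltaC c f hf := by
  have hδ := deltaC_nonneg c f hf
  have hg : MemLp (fun x => (((c / (2 * Real.pi)) ^ 3 : ℝ) : ℂ) *
      finiteFT c (fun ω => fourier f hf (c • ω)) x) 2 volume :=
    (memLp_finiteFT hc (memLp_fourier_smul hc f hf)).const_mul _
  have hd := integral_norm_sq_sub_finiteFT hc hf
  set g : E3 → ℂ := fun x => (((c / (2 * Real.pi)) ^ 3 : ℝ) : ℂ) *
      finiteFT c (fun ω => fourier f hf (c • ω)) x with hgdef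
  rw [← ENNReal.ofReal_le_ofReal_iff (by positivity),
    ← eLpNorm_two_eq_ofReal_sqrt (hg.restrict unitBallᶜ), ENNReal.ofReal_add hε hδ]
  have e : g = f - (f - g) := by abel
  calc eLpNorm g 2 (volume.restrict unitBallᶜ)
      ≤ eLpNorm f 2 (volume.restrict unitBallᶜ) +
          eLpNorm (f - g) 2 (volume.restrict unitBallᶜ) := by
        conv_lhs => rw [e]
        exact eLpNorm_sub_le (hf.restrict _).1 ((hf.sub hg).restrict _).1 (by norm_num)
    _ ≤ ENNReal.ofReal ε + ENNReal.ofReal (deltaC c f hf) := by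
        gcongr
        · rwa [← eLpNorm_indicator_eq_eLpNorm_restrict
            Metric.isClosed_closedBall.measurableSet.compl]
        · refine (eLpNorm_mono_measure _ Measure.restrict_le_self).trans ?_
          rw [eLpNorm_two_eq_ofReal_sqrt (hf.sub hg)]
          simp only [Pi.sub_apply, hgdef]
          rw [hd, Real.sqrt_sq hδ]

theorem IsSystem.coeffB_eq {c : ℝ} (hc : 0 < c) {ψ : Index → E3 → ℂ} {α : ℕ → ℕ → ℂ}
    (hψ : IsSystem c ψ α) (f : E3 → ℂ) (hf : MemLp f 2 volume) (i : Index) :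
    coeffB c ψ f hf i = (((c / (2 * Real.pi)) ^ 3 : ℝ) : ℂ) *
      inner ℂ (hψ.hilbertBasis i) ((memLp_fourier_smul hc f hf).toLp _) := by
  rw [hψ.hilbertBasis_apply, hψ.inner_toLp, coeffB]

/-- The expansion error of the band-limited part of `f`. -/
theorem IsSystem.eLpNorm_sub_sum_le {c : ℝ} (hc : 0 < c) {ψ : Index → E3 → ℂ} {α : ℕ → ℕ → ℂ}
    (hψ : IsSystem c ψ α) (f : E3 → ℂ) (hf : MemLp f 2 volume) (P : Finset Index) {M : ℝ}
    (hM : 0 ≤ M)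
    (hP : ∀ i, i ∉ P → alphaTilde c α i.N i.n ≤ M * (1 - alphaTilde c α i.N i.n)) :
    eLpNorm (fun x => (((c / (2 * Real.pi)) ^ 3 : ℝ) : ℂ) *
        finiteFT c (fun ω => fourier f hf (c • ω)) x -
          ∑ i ∈ P, coeffB c ψ f hf i * α i.N i.n * ψ i x) 2 (volume.restrict unitBall) ≤
      ENNReal.ofReal (Real.sqrt M * Real.sqrt (∫ x in unitBallᶜ,
        ‖(((c / (2 * Real.pi)) ^ 3 : ℝ) : ℂ) *
          finiteFT c (fun ω => fourier f hf (c • ω)) x‖ ^ 2)) := by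
  have hh := memLp_fourier_smul hc f hf
  set u : E3 → ℂ := fun ω => fourier f hf (c • ω) with hu
  set h := hh.toLp u with hhdef
  have hκ : 0 < (c / (2 * Real.pi)) ^ 3 := by positivity
  have hcoeff := hψ.coeffB_eq hc f hf
  have htilde : ∀ i : Index, alphaTilde c α i.N i.n =
    (c / (2 * Real.pi)) ^ 3 * ‖α i.N i.n‖ ^ 2 := fun i => rfl
  have hplanch := GPSWF.integral_norm_sq_finiteFT hc hh
  set k := (c / (2 * Real.pi)) ^ 3 with hk
  set v := h - ∑ i ∈ P, inner ℂ (hψ.hilbertBasis i) h • hψ.hilbertBasis i with hv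
  have hGL : finiteFT c h = finiteFT c u := finiteFT_congr_ae hh.coeFn_toLp c
  -- The constant k⁻¹ = κ⁻³ is the one for which k⁻¹ - |α|² is the energy of T ψ outside R.
  have hbound : ‖finiteFTOp c v‖ ^ 2 ≤ M * (k⁻¹ * ‖h‖ ^ 2 - ‖finiteFTOp c h‖ ^ 2) := by
    refine norm_sq_apply_sub_sum_le hψ.hilbertBasis hψ.inner_hilbertBasis_finiteFTOp P hM
      (fun i => ?_) (fun i hi => ?_) h
    · rw [← one_div, le_div_iff₀ hκ, mul_comm, ← htilde]
      exact (hψ.alphaTilde_lt_one hc _ _).le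
    · have h1 := hP i hi
      rw [htilde] at h1
      have h2 : k * (M * (k⁻¹ - ‖α i.N i.n‖ ^ 2)) = M * (1 - k * ‖α i.N i.n‖ ^ 2) := by
        field_simp
      rw [← h2] at h1
      exact le_of_mul_le_mul_left h1 hκ
  have houter : k⁻¹ * ‖h‖ ^ 2 - ‖finiteFTOp c h‖ ^ 2 =
      ∫ x in unitBallᶜ, ‖finiteFT c u x‖ ^ 2 := by
    have h1 := integral_add_compl (μ := volume) (s := unitBall)
      Metric.isClosed_closedBall.measurableSet
      ((memLp_finiteFT hc hh).integrable_norm_pow (by norm_num))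
    have h2 : ‖finiteFTOp c h‖ ^ 2 = ∫ x in unitBall, ‖finiteFT c u x‖ ^ 2 := by
      rw [norm_Lp_sq]
      refine integral_congr_ae ?_
      filter_upwards [coeFn_finiteFTOp c h] with x hx
      rw [hx, hGL]
    rw [hhdef, norm_toLp_sq, ← hplanch, ← hhdef, h2, ← h1, inv_mul_cancel_left₀ hκ.ne']
    ring
  have hTv : finiteFTOp c v = finiteFTOp c h -
      ∑ i ∈ P, (inner ℂ (hψ.hilbertBasis i) h * α i.N i.n) • hψ.hilbertBasis i := by
    rw [hv, map_sub, map_sum]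
    congr 1
    refine Finset.sum_congr rfl fun i _ => ?_
    rw [map_smul, hψ.hilbertBasis_apply, hψ.finiteFTOp_toLp, smul_smul]
  have hae : (fun x => (k : ℂ) * finiteFT c u x -
      ∑ i ∈ P, coeffB c ψ f hf i * α i.N i.n * ψ i x) =ᵐ[volume.restrict unitBall]
      ((k : ℂ) • finiteFTOp c v : Lp ℂ 2 ((volume : Measure E3).restrict unitBall)) := by
    have hsum : ∀ᵐ x ∂(volume.restrict unitBall), ∀ i ∈ P,
        ((inner ℂ (hψ.hilbertBasis i) h * α i.N i.n) • hψ.hilbertBasis i :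
          Lp ℂ 2 ((volume : Measure E3).restrict unitBall)) x =
        (inner ℂ (hψ.hilbertBasis i) h * α i.N i.n) * ψ i x := by
      rw [Filter.eventually_all_finset]
      intro i _
      filter_upwards [Lp.coeFn_smul (inner ℂ (hψ.hilbertBasis i) h * α i.N i.n)
        (hψ.hilbertBasis i), (hψ.eigen i).memLp.coeFn_toLp] with x h1 h2
      rw [h1, Pi.smul_apply, hψ.hilbertBasis_apply, h2, smul_eq_mul]
    rw [hTv]
    filter_upwards [hsum, coeFn_finiteFTOp c h, Lp.coeFn_smul (k : ℂ) (finiteFTOp c h -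
      ∑ i ∈ P, (inner ℂ (hψ.hilbertBasis i) h * α i.N i.n) • hψ.hilbertBasis i),
      Lp.coeFn_sub (finiteFTOp c h)
        (∑ i ∈ P, (inner ℂ (hψ.hilbertBasis i) h * α i.N i.n) • hψ.hilbertBasis i),
      Lp.coeFn_finsetSum P
        (fun i => (inner ℂ (hψ.hilbertBasis i) h * α i.N i.n) • hψ.hilbertBasis i)]
      with x h1 h2 h3 h4 h5
    rw [h3, Pi.smul_apply, h4, Pi.sub_apply, h5, Finset.sum_apply, Finset.sum_congr rfl h1, h2, hGL,
      smul_eq_mul, mul_sub, Finset.mul_sum]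
    congr 1
    refine Finset.sum_congr rfl fun i _ => ?_
    rw [hcoeff]; ring
  have hnorm : ‖(k : ℂ) • finiteFTOp c v‖ ^ 2 ≤
      M * ∫ x in unitBallᶜ, ‖(k : ℂ) * finiteFT c u x‖ ^ 2 := by
    have h1 : ∫ x in unitBallᶜ, ‖(k : ℂ) * finiteFT c u x‖ ^ 2 =
        k ^ 2 * ∫ x in unitBallᶜ, ‖finiteFT c u x‖ ^ 2 := by
      rw [← integral_const_mul]
      congr 1; funext x
      rw [norm_mul, mul_pow, Complex.norm_real, Real.norm_of_nonneg hκ.le]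
    rw [h1, ← houter, norm_smul, mul_pow, Complex.norm_real, Real.norm_of_nonneg hκ.le]
    calc _ ≤ k ^ 2 * (M * (k⁻¹ * ‖h‖ ^ 2 - ‖finiteFTOp c h‖ ^ 2)) := by gcongr
      _ = _ := by ring
  rw [eLpNorm_congr_ae hae, ← Lp.enorm_def, ← ofReal_norm, ← Real.sqrt_mul hM]
  exact ENNReal.ofReal_le_ofReal (Real.le_sqrt_of_sq_le hnorm)

end GPSWF

theorem mainTheorem2
    (c : ℝ) (hc : 0 < c) (L : ℕ) (hL : 0 < L)
    (ψ : GPSWF.Index → GPSWF.E3 → ℂ) (α : ℕ → ℕ → ℂ) (hψ : GPSWF.IsSystem c ψ α)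
    (f : GPSWF.E3 → ℂ) (hf : MemLp f 2 volume) (ε : ℝ) (hε : 0 ≤ ε)
    (hconc : eLpNorm (GPSWF.unitBallᶜ.indicator f) 2 volume ≤ ENNReal.ofReal ε)
    (hsamples : Memℓp (fun k : Fin 3 → ℤ => f (GPSWF.gridPoint L k)) 2)
    (P : Finset GPSWF.Index) :
    (∀ N n, GPSWF.alphaTilde c α N n < 1) ∧
    ∃ M : ℝ,
      IsGreatest {t : ℝ | ∃ i : GPSWF.Index, i ∉ P ∧
        t = GPSWF.alphaTilde c α i.N i.n / (1 - GPSWF.alphaTilde c α i.N i.n)} M ∧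
      eLpNorm (fun x => f x - ∑ i ∈ P, GPSWF.coeffB c ψ f hf i * α i.N i.n * ψ i x) 2
          (volume.restrict GPSWF.unitBall)
        ≤ ENNReal.ofReal
            ((ε + GPSWF.deltaC c f hf) * Real.sqrt M + 2 * GPSWF.deltaC c f hf) := by
  have hlt := hψ.alphaTilde_lt_one hc
  have hδ := GPSWF.deltaC_nonneg c f hf
  have hnn : ∀ N n, 0 ≤ GPSWF.alphaTilde c α N n := fun N n => by
    unfold GPSWF.alphaTilde; positivity
  have hpos : ∀ N n, 0 < 1 - GPSWF.alphaTilde c α N n := fun N n => sub_pos.2 (hlt N n)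
  have htend : Filter.Tendsto (fun i : GPSWF.Index => GPSWF.alphaTilde c α i.N i.n /
      (1 - GPSWF.alphaTilde c α i.N i.n)) Filter.cofinite (nhds 0) := by
    have h1 : Filter.Tendsto (fun i : GPSWF.Index => GPSWF.alphaTilde c α i.N i.n)
        Filter.cofinite (nhds 0) := by
      simpa [GPSWF.alphaTilde] using hψ.tendsto_norm_sq.const_mul ((c / (2 * Real.pi)) ^ 3)
    simpa using! h1.div (h1.const_sub 1) (by norm_num)
  obtain ⟨j, hj, hmax⟩ := GPSWF.exists_isMaxOn_of_tendsto_cofinite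
    (fun i : GPSWF.Index => div_nonneg (hnn i.N i.n) (hpos i.N i.n).le) htend
    (s := {i | i ∉ P}) (Infinite.exists_notMem_finset P)
  refine ⟨hlt, _, ⟨⟨j, hj, rfl⟩, ?_⟩, ?_⟩
  · rintro _ ⟨i, hi, rfl⟩
    exact hmax i hi
  set M := GPSWF.alphaTilde c α j.N j.n / (1 - GPSWF.alphaTilde c α j.N j.n)
  have hM : 0 ≤ M := div_nonneg (hnn j.N j.n) (hpos j.N j.n).le
  have htail := hψ.eLpNorm_sub_sum_le hc f hf P hM fun i hi =>
    (div_le_iff₀ (hpos i.N i.n)).1 (hmax i hi)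
  have hout := GPSWF.sqrt_setIntegral_compl_le hc hf hε hconc
  have hg : MemLp (fun x => (((c / (2 * Real.pi)) ^ 3 : ℝ) : ℂ) *
      GPSWF.finiteFT c (fun ω => GPSWF.fourier f hf (c • ω)) x) 2 volume :=
    (GPSWF.memLp_finiteFT hc (GPSWF.memLp_fourier_smul hc f hf)).const_mul _
  have hd := GPSWF.integral_norm_sq_sub_finiteFT hc hf
  set g : GPSWF.E3 → ℂ := fun x => (((c / (2 * Real.pi)) ^ 3 : ℝ) : ℂ) *
      GPSWF.finiteFT c (fun ω => GPSWF.fourier f hf (c • ω)) x with hgdef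
  have hs : MemLp (fun x => ∑ i ∈ P, GPSWF.coeffB c ψ f hf i * α i.N i.n * ψ i x) 2
      (volume.restrict GPSWF.unitBall) :=
    memLp_finsetSum P fun i _ => (hψ.eigen i).memLp.const_mul _
  have hfg : eLpNorm (f - g) 2 (volume.restrict GPSWF.unitBall) ≤
      ENNReal.ofReal (GPSWF.deltaC c f hf) := by
    refine (eLpNorm_mono_measure _ Measure.restrict_le_self).trans ?_
    rw [GPSWF.eLpNorm_two_eq_ofReal_sqrt (hf.sub hg)]
    simp only [Pi.sub_apply, hgdef]
    rw [hd, Real.sqrt_sq hδ]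
  have e : (fun x => f x - ∑ i ∈ P, GPSWF.coeffB c ψ f hf i * α i.N i.n * ψ i x) =
      (f - g) + fun x => g x - ∑ i ∈ P, GPSWF.coeffB c ψ f hf i * α i.N i.n * ψ i x := by
    funext x; simp
  rw [e]
  refine (eLpNorm_add_le ((hf.sub hg).restrict _).1 ((hg.restrict _).sub hs).1
    (by norm_num)).trans ((add_le_add hfg htail).trans ?_)
  rw [← ENNReal.ofReal_add hδ (by positivity)]
  refine ENNReal.ofReal_le_ofReal ?_
  -- The estimate obtained has a single δ_c, from f - g on R, next to (ε + δ_c)√M; the second δ_c in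
  -- the claim is slack.
  have := mul_le_mul_of_nonneg_left hout (Real.sqrt_nonneg M)
  linarith
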